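/- **Setting.** Let $(\Omega,\mathcal F,\{\mathcal F_t\},\mathbb P)$ be a complete filtered probability space with predictable $\sigma$-algebra $\mathcal P$, let $(W^k)_{k\ge 1}$ be a sequence of independent $\{\mathcal F_t\}$-Wiener processes, $T>0$, $\mathbb T^d$ the $d$-dimensional torus, $Q_T=[0,T]\times\mathbb T^d$, $\Omega_T=\Omega\times[0,T]$. For $g:\mathbb R\to\mathbb R$ write $[\![g]\!](r)=\int_0^r g(s)\,ds$. Let $m>1$, $\kappa\in(0,1/2]$, $K\ge 1$, $N_0\ge 0$, and assume: 1. $\Phi:\mathbb R\to\mathbb R$ is differentiable, strictly increasing and odd; $\zeta:=\sqrt{\Phi'}$ is differentiable away from $0$, with $|\zeta(0)|\le K$, $|\zeta'(r)|\le K|r|^{(m-3)/2}$ for $r>0$, $K\zeta(r)\ge \mathbf 1_{\{|r|\ge1\}}$, and $K\big|[\![\zeta]\!](r)-[\![\zeta]\!](s)\big|$ is at least $|r-s|$ if $|r|\vee|s|\ge 1$ and at least $|r-s|^{(m+1)/2}$ if $|r|\vee|s|<1$. 2. $\xi\ge 0$ is an $\mathcal F_0$-measurable $L_{m+1}(\mathbb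 T^d)$-valued random variable with $\mathbb E\|\xi\|_{L_{m+1}(\mathbb T^d)}^{m+1}<\infty$. 3. $\sigma=(\sigma^k)_k:\mathbb R\to \ell_2$ satisfies $\sigma(0)=0$ and $|\sigma(r)-\sigma(s)|_{\ell_2}\le K(|r-s|^{1/2+\kappa}+|r-s|)$. 4. $F:Q_T\times\mathbb R\to\mathbb R$ is measurable, $F(t,x,0)=0$, and $|F(t,x_1,r_1)-F(t,x_2,r_2)|\le K|x_1-x_2|^\kappa+N_0|r_1-r_2|$. 5. The obstacle $S$ is a continuous adapted real-valued process on $[0,T]$ with $dS=h_S\,dt+\sum_k\sigma^k(S)\,dW^k_t$, $S(0)=S_0$, where $h_S\in L_2(\Omega_T)$ and $S_0\in L_2(\Omega)$; moreover $S(t)\ge 0$ for all $t\in[0,T]$ and $S_0\ge\xi$. An *entropy solution* of the obstacle problem $\Pi_S(\Phi,F,\xi)$, $$du=[\Delta\Phi(u)+F(t,x,u)]\,dt-\nu\,dt+\sum_k\sigma^k(u)\,dW^k_t,\quad u\le S,\quad u(0)=\xi,\quad \int_{Q_T}(u-S)\,\nu\,dt\,dx=0,$$ is a pair $(u,\nu)$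 of predictable processes such that * (i) $u\in L_{m+1}(\Omega_T;L_{m+1}(\mathbb T^d))$, $\nu\in L_2(\Omega_T;L_2(\mathbb T^d))$ and $\nu\ge 0$; * (ii) for all $f\in C_b(\mathbb R)$, $[\![\zeta f]\!](u)\in L_2(\Omega_T;H^1(\mathbb T^d))$ and $\partial_{x_i}[\![\zeta f]\!](u)=f(u)\,\partial_{x_i}[\![\zeta]\!](u)$; * (iii) for all convex $\eta\in C^2(\mathbb R)$ with $\eta''$ compactly supported, all $\varphi\in C_c^\infty([0,T))$ and $\varrho\in C^\infty(\mathbb T^d)$ with $\phi:=\varphi\varrho\ge 0$, almost surely $$\begin{aligned}-\int_{Q_T}\eta(u)\,\partial_t\phi\,dx\,dt\le{}&\int_{\mathbb T^d}\eta(\xi)\phi(0)\,dx+\int_{Q_T}[\![\zeta^2\eta']\!](u)\,\Delta\phi\,dx\,dt+\int_{Q_T}\eta'(u)\big(F(t,x,u)-\nu\big)\phi\,dx\,dt\\&+\int_{Q_T}\Big(\tfrac12\eta''(u)\sum_k|\sigma^k(u)|^2\phi-\eta''(u)\,\big|\nabla[\![\zeta]\!](u)\big|^2\phi\Big)dx\,dt+\sum_k\int_0^T\!\!\int_{\mathbb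 T^d}\eta'(u)\,\phi\,\sigma^k(u)\,dx\,dW^k_t;\end{aligned}$$ * (iv) $u\le S$ a.e. in $Q_T$, almost surely, and $\int_{Q_T}(u-S)\,\nu\,dt\,dx=0$ almost surely. **Proposition.** Under assumptions 1–5, if $(u,\nu)$ is an entropy solution of $\Pi_S(\Phi,F,\xi)$, then $u\ge 0$ a.e. in $Q_T$, almost surely. -/

import Mathlib

open MeasureTheory ProbabilityTheory Filter Topology
open scoped NNReal ENNReal BoundedContinuousFunction

noncomputable section

namespace StochasticPorousMedia

/-! ### Space, time, and derivatives on the torus -/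

/-- The `d`-dimensional torus `𝕋ᵈ = (ℝ/ℤ)ᵈ`. -/
abbrev Torus (d : ℕ) : Type := UnitAddTorus (Fin d)

/-- The Euclidean (flat) distance on the torus. -/
def torusDist {d : ℕ} (x y : Torus d) : ℝ :=
  Real.sqrt (∑ i, ‖x i - y i‖ ^ 2)

/-- Lebesgue measure on the time interval `[0,T]`, as a measure on `ℝ≥0`. -/
def timeMeasure (T : ℝ≥0) : Measure ℝ≥0 :=
  Measure.map Real.toNNReal ((volume : Measure ℝ).restrict (Set.Icc 0 (T : ℝ)))

/-- Lebesgue measure `dt dx` on `Q_T = [0,T] × 𝕋ᵈ`. -/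
def spaceTime (T : ℝ≥0) (d : ℕ) : Measure (ℝ≥0 × Torus d) :=
  (timeMeasure T).prod volume

/-- `C^∞(𝕋ᵈ)`: the periodic lift to `ℝᵈ` is smooth. -/
def IsSmoothOnTorus {d : ℕ} (ψ : Torus d → ℝ) : Prop :=
  ContDiff ℝ ((⊤ : ℕ∞) : WithTop ℕ∞) (fun y : Fin d → ℝ => ψ (fun i => (y i : UnitAddCircle)))

/-- The partial derivative `∂_{x_i} ψ` on the torus. -/
def partialDeriv {d : ℕ} (i : Fin d) (ψ : Torus d → ℝ) (x : Torus d) : ℝ :=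
  deriv (fun s : ℝ => ψ (x + Pi.single i (s : UnitAddCircle))) 0

/-- The Laplacian `Δψ` on the torus. -/
def laplacian {d : ℕ} (ψ : Torus d → ℝ) (x : Torus d) : ℝ :=
  ∑ i, partialDeriv i (partialDeriv i ψ) x

/-- `g` is the weak gradient of `v` on the torus. -/
def HasWeakGradient {d : ℕ} (v : Torus d → ℝ) (g : Fin d → Torus d → ℝ) : Prop :=
  ∀ ψ : Torus d → ℝ, IsSmoothOnTorus ψ → ∀ i,
    ∫ x, v x * partialDeriv i ψ x = -∫ x, g i x * ψ x

/-- `⟦g⟧(r) = ∫₀ʳ g(s) ds`. -/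
def primitive (g : ℝ → ℝ) (r : ℝ) : ℝ := ∫ s in (0 : ℝ)..r, g s

/-! ### Random fields -/

variable {Ω : Type*} {mΩ : MeasurableSpace Ω}

/-- `dt ⊗ dℙ` on `Ω_T` (time is written as the first coordinate). -/
def timeOmega (P : Measure Ω) (T : ℝ≥0) : Measure (ℝ≥0 × Ω) :=
  (timeMeasure T).prod P

/-- `v ∈ L_p(Ω_T; L_p(𝕋ᵈ))`. -/
def MemLpField {d : ℕ} (P : Measure Ω) (T : ℝ≥0) (p : ℝ) (v : ℝ≥0 → Ω → Torus d → ℝ) : Prop :=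
  MemLp (fun z : (ℝ≥0 × Ω) × Torus d => v z.1.1 z.1.2 z.2) (ENNReal.ofReal p)
    ((timeOmega P T).prod volume)

/-- `v` is a predictable field: `(t, ω, x) ↦ v t ω x` is measurable for the product of the
predictable σ-algebra on `Ω_T` and the Borel σ-algebra of the torus. -/
def IsPredictableField {d : ℕ} (ℱ : Filtration ℝ≥0 mΩ) (v : ℝ≥0 → Ω → Torus d → ℝ) : Prop :=
  @Measurable ((ℝ≥0 × Ω) × Torus d) ℝ (ℱ.predictable.prod inferInstance) inferInstance
    (fun z => v z.1.1 z.1.2 z.2)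

/-- `v ∈ L₂(Ω_T; H¹(𝕋ᵈ))`, with spatial weak gradient `G`. -/
structure IsL2H1 {d : ℕ} (P : Measure Ω) (T : ℝ≥0) (v : ℝ≥0 → Ω → Torus d → ℝ)
    (G : Fin d → ℝ≥0 → Ω → Torus d → ℝ) : Prop where
  mem_fun : MemLpField P T 2 v
  mem_grad : ∀ i, MemLpField P T 2 (G i)
  weak_grad : ∀ᵐ q ∂(timeOmega P T), HasWeakGradient (v q.1 q.2) (fun i => G i q.1 q.2)

/-! ### Wiener processes and the Itô integral -/

/-- `(W^k)` is a sequence of independent Wiener processes with respect to the filtration `ℱ`: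
they are adapted and the increments of the whole family after time `s` are independent
of `ℱ s`. -/
structure IsWienerSequence (ℱ : Filtration ℝ≥0 mΩ) (P : Measure Ω)
    (W : ℕ → ℝ≥0 → Ω → ℝ) : Prop where
  brownian : ∀ k, IsBrownianReal (W k) P
  adapted : ∀ k t, Measurable[ℱ t] (W k t)
  indep : iIndepFun (fun k ω => fun t : ℝ≥0 => W k t ω) P
  indep_past : ∀ s t : ℝ≥0, s ≤ t →
    Indep (MeasurableSpace.comap (fun ω => fun k : ℕ => W k t ω - W k s ω) inferInstance) (ℱ s) P

/-- An elementary predictable integrand for `(W^k)`: a finite sum of terms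
`coeff i · 1_{(left i, right i]}` in the `noise i`-th component, where `coeff i` is bounded and
`ℱ (left i)`-measurable. -/
structure ElementaryIntegrand (ℱ : Filtration ℝ≥0 mΩ) where
  card : ℕ
  noise : Fin card → ℕ
  left : Fin card → ℝ≥0
  right : Fin card → ℝ≥0
  left_le_right : ∀ i, left i ≤ right i
  coeff : Fin card → Ω → ℝ
  measurable_coeff : ∀ i, Measurable[ℱ (left i)] (coeff i)
  bounded_coeff : ∀ i, ∃ C : ℝ, ∀ ω, |coeff i ω| ≤ C

/-- The `k`-th component of an elementary integrand at time `t`. -/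
def ElementaryIntegrand.toFun {ℱ : Filtration ℝ≥0 mΩ} (V : ElementaryIntegrand ℱ)
    (k : ℕ) (t : ℝ≥0) (ω : Ω) : ℝ :=
  ∑ i, if V.noise i = k ∧ V.left i < t ∧ t ≤ V.right i then V.coeff i ω else 0

/-- `∑ₖ ∫₀ᵀ V^k dW^k` for an elementary integrand. -/
def ElementaryIntegrand.integral {ℱ : Filtration ℝ≥0 mΩ} (V : ElementaryIntegrand ℱ)
    (W : ℕ → ℝ≥0 → Ω → ℝ) (T : ℝ≥0) (ω : Ω) : ℝ :=
  ∑ i, V.coeff i ω *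
    (W (V.noise i) (min (V.right i) T) ω - W (V.noise i) (min (V.left i) T) ω)

/-- `I = ∑ₖ ∫₀ᵀ H^k dW^k` for an `ℓ²`-valued integrand `H ∈ L₂(Ω_T; ℓ²)`: `H` is the
`L₂`-limit of elementary integrands whose integrals converge to `I` in `L₂(Ω)`. -/
def IsItoIntegralL2 (ℱ : Filtration ℝ≥0 mΩ) (P : Measure Ω) (W : ℕ → ℝ≥0 → Ω → ℝ) (T : ℝ≥0)
    (H : ℕ → ℝ≥0 → Ω → ℝ) (I : Ω → ℝ) : Prop :=
  (∀ k, AEStronglyMeasurable (fun q : ℝ≥0 × Ω => H k q.1 q.2) (timeOmega P T)) ∧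
  AEStronglyMeasurable I P ∧
  ∃ V : ℕ → ElementaryIntegrand ℱ,
    Tendsto (fun n => ∫⁻ q, ∑' k, ENNReal.ofReal (((V n).toFun k q.1 q.2 - H k q.1 q.2) ^ 2)
      ∂(timeOmega P T)) atTop (𝓝 0) ∧
    Tendsto (fun n => ∫⁻ ω, ENNReal.ofReal (((V n).integral W T ω - I ω) ^ 2) ∂P) atTop (𝓝 0)

/-- `I = ∑ₖ ∫₀ᵀ H^k dW^k` for a locally square integrable integrand: along a localizing sequence
of stopping times `τ n`, the integrand `1_{t ≤ τ n} H` has the `L₂`-Itô integral `J n`, and almost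
surely `T ≤ τ n` and `J n = I` for all large `n`. -/
def IsItoIntegral (ℱ : Filtration ℝ≥0 mΩ) (P : Measure Ω) (W : ℕ → ℝ≥0 → Ω → ℝ) (T : ℝ≥0)
    (H : ℕ → ℝ≥0 → Ω → ℝ) (I : Ω → ℝ) : Prop :=
  ∃ (τ : ℕ → Ω → WithTop ℝ≥0) (J : ℕ → Ω → ℝ),
    (∀ n, IsStoppingTime ℱ (τ n)) ∧
    (∀ n, IsItoIntegralL2 ℱ P W T
      (fun k t ω => Set.indicator {s : ℝ≥0 | (s : WithTop ℝ≥0) ≤ τ n ω} (fun s => H k s ω) t)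
      (J n)) ∧
    ∀ᵐ ω ∂P, ∃ N, ∀ n ≥ N, (T : WithTop ℝ≥0) ≤ τ n ω ∧ J n ω = I ω

/-! ### Assumptions on the data -/

/-- `ζ = √Φ'`. -/
def zeta (Φ : ℝ → ℝ) (r : ℝ) : ℝ := Real.sqrt (deriv Φ r)

/-- The assumption on the nonlinearity `Φ`. -/
structure NonlinearityAssumption (m K : ℝ) (Φ : ℝ → ℝ) : Prop where
  differentiable : Differentiable ℝ Φ
  strictMono : StrictMono Φ
  odd : Function.Odd Φ
  differentiableAt_zeta : ∀ r, r ≠ 0 → DifferentiableAt ℝ (zeta Φ) r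
  zeta_zero : |zeta Φ 0| ≤ K
  deriv_zeta : ∀ r, 0 < r → |deriv (zeta Φ) r| ≤ K * |r| ^ ((m - 3) / 2)
  zeta_lower : ∀ r, 1 ≤ |r| → 1 ≤ K * zeta Φ r
  primitive_lower_large : ∀ r s, 1 ≤ max |r| |s| →
    |r - s| ≤ K * |primitive (zeta Φ) r - primitive (zeta Φ) s|
  primitive_lower_small : ∀ r s, max |r| |s| < 1 →
    |r - s| ^ ((m + 1) / 2) ≤ K * |primitive (zeta Φ) r - primitive (zeta Φ) s|

/-- The assumption on the initial condition `ξ`. -/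
structure InitialAssumption {d : ℕ} (ℱ : Filtration ℝ≥0 mΩ) (P : Measure Ω) (m : ℝ)
    (ξ : Ω → Torus d → ℝ) : Prop where
  measurable : @Measurable (Ω × Torus d) ℝ ((ℱ 0).prod inferInstance) inferInstance
    (fun z => ξ z.1 z.2)
  nonneg : ∀ᵐ z ∂(P.prod volume), 0 ≤ ξ z.1 z.2
  memLp : MemLp (fun z : Ω × Torus d => ξ z.1 z.2) (ENNReal.ofReal (m + 1)) (P.prod volume)

/-- The assumption on the diffusion coefficient `σ : ℝ → ℓ²`. -/
structure DiffusionAssumption (κ K : ℝ) (σ : ℝ → lp (fun _ : ℕ => ℝ) 2) : Prop where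
  zero : σ 0 = 0
  holder : ∀ r s, ‖σ r - σ s‖ ≤ K * (|r - s| ^ (1 / 2 + κ) + |r - s|)

/-- The assumption on the source term `F : Q_T × ℝ → ℝ`. -/
structure SourceAssumption {d : ℕ} (T : ℝ≥0) (κ K N₀ : ℝ) (F : ℝ≥0 → Torus d → ℝ → ℝ) :
    Prop where
  measurable : Measurable (fun z : ℝ≥0 × Torus d × ℝ => F z.1 z.2.1 z.2.2)
  zero : ∀ t ≤ T, ∀ x, F t x 0 = 0
  holder : ∀ t ≤ T, ∀ x₁ x₂ r₁ r₂,
    |F t x₁ r₁ - F t x₂ r₂| ≤ K * torusDist x₁ x₂ ^ κ + N₀ * |r₁ - r₂|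

/-- The assumption on the obstacle: `S` is a continuous adapted nonnegative solution of
`dS = h dt + ∑ₖ σ^k(S) dW^k` on `[0,T]`, with `h ∈ L₂(Ω_T)`, `S(0) ∈ L₂(Ω)` and `S(0) ≥ ξ`. -/
structure ObstacleAssumption {d : ℕ} (ℱ : Filtration ℝ≥0 mΩ) (P : Measure Ω)
    (W : ℕ → ℝ≥0 → Ω → ℝ) (T : ℝ≥0) (σ : ℝ → lp (fun _ : ℕ => ℝ) 2)
    (ξ : Ω → Torus d → ℝ) (h S : ℝ≥0 → Ω → ℝ) : Prop where
  drift_memLp : MemLp (fun q : ℝ≥0 × Ω => h q.1 q.2) 2 (timeOmega P T)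
  initial_memLp : MemLp (S 0) 2 P
  adapted : ∀ t ≤ T, Measurable[ℱ t] (S t)
  continuous : ∀ᵐ ω ∂P, ContinuousOn (fun t => S t ω) (Set.Iic T)
  equation : ∀ t ≤ T, IsItoIntegral ℱ P W t (fun k r ω => σ (S r ω) k)
    (fun ω => S t ω - S 0 ω - ∫ r, h r ω ∂(timeMeasure t))
  nonneg : ∀ᵐ ω ∂P, ∀ t ≤ T, 0 ≤ S t ω
  initial_ge : ∀ᵐ z ∂(P.prod (volume : Measure (Torus d))), ξ z.1 z.2 ≤ S 0 z.1

/-! ### Entropy solutions of the obstacle problem -/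

/-- The set `ℰ` of entropies: convex `C²` functions whose second derivative has compact support. -/
structure IsEntropy (η : ℝ → ℝ) : Prop where
  contDiff : ContDiff ℝ 2 η
  convex : ConvexOn ℝ Set.univ η
  compact : HasCompactSupport (deriv (deriv η))

/-- `φ ∈ C_c^∞([0,T))`, extended smoothly to `ℝ`. -/
structure IsTimeTest (T : ℝ≥0) (φ : ℝ → ℝ) : Prop where
  contDiff : ContDiff ℝ ((⊤ : ℕ∞) : WithTop ℕ∞) φ
  vanish : ∃ T' < (T : ℝ), ∀ t, T' ≤ t → φ t = 0

/-- The entropy inequality for `η` and the test function `φ(t) ϱ(x)`; here `G` stands for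
`∇⟦ζ⟧(u)` and `I` for `∑ₖ ∫₀ᵀ ∫ η'(u) φ ϱ σ^k(u) dx dW^k`. -/
def EntropyInequality {d : ℕ} (T : ℝ≥0) (Φ : ℝ → ℝ) (F : ℝ≥0 → Torus d → ℝ → ℝ)
    (σ : ℝ → lp (fun _ : ℕ => ℝ) 2) (ξ : Ω → Torus d → ℝ)
    (u ν : ℝ≥0 → Ω → Torus d → ℝ) (G : Fin d → ℝ≥0 → Ω → Torus d → ℝ)
    (η φ : ℝ → ℝ) (ϱ : Torus d → ℝ) (I : Ω → ℝ) (ω : Ω) : Prop :=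
  -∫ z, η (u z.1 ω z.2) * (deriv φ z.1 * ϱ z.2) ∂(spaceTime T d) ≤
    (∫ x, η (ξ ω x) * (φ 0 * ϱ x)) +
    (∫ z, primitive (fun r => zeta Φ r ^ 2 * deriv η r) (u z.1 ω z.2) *
      (φ z.1 * laplacian ϱ z.2) ∂(spaceTime T d)) +
    (∫ z, deriv η (u z.1 ω z.2) * (F z.1 z.2 (u z.1 ω z.2) - ν z.1 ω z.2) *
      (φ z.1 * ϱ z.2) ∂(spaceTime T d)) +
    (∫ z, (1 / 2 * deriv (deriv η) (u z.1 ω z.2) *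
        (∑' k, |σ (u z.1 ω z.2) k| ^ 2) * (φ z.1 * ϱ z.2) -
      deriv (deriv η) (u z.1 ω z.2) * (∑ i, G i z.1 ω z.2 ^ 2) * (φ z.1 * ϱ z.2))
      ∂(spaceTime T d)) +
    I ω

/-- `(u, ν)` is an entropy solution of the obstacle problem `Π_S(Φ, F, ξ)`. -/
structure IsEntropySolution {d : ℕ} (ℱ : Filtration ℝ≥0 mΩ) (P : Measure Ω)
    (W : ℕ → ℝ≥0 → Ω → ℝ) (T : ℝ≥0) (m : ℝ) (Φ : ℝ → ℝ) (F : ℝ≥0 → Torus d → ℝ → ℝ)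
    (σ : ℝ → lp (fun _ : ℕ => ℝ) 2) (ξ : Ω → Torus d → ℝ) (S : ℝ≥0 → Ω → ℝ)
    (u ν : ℝ≥0 → Ω → Torus d → ℝ) : Prop where
  predictable_u : IsPredictableField ℱ u
  predictable_ν : IsPredictableField ℱ ν
  mem_u : MemLpField P T (m + 1) u
  mem_ν : MemLpField P T 2 ν
  nonneg_ν : ∀ᵐ ω ∂P, ∀ᵐ z ∂(spaceTime T d), 0 ≤ ν z.1 ω z.2
  /-- `G` is `∇⟦ζ⟧(u)`; the chain rule holds for `⟦ζ f⟧(u)`, and the entropy inequality holds. -/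
  gradient_and_entropy : ∃ G : Fin d → ℝ≥0 → Ω → Torus d → ℝ,
    IsL2H1 P T (fun t ω x => primitive (zeta Φ) (u t ω x)) G ∧
    (∀ f : ℝ →ᵇ ℝ,
      IsL2H1 P T (fun t ω x => primitive (fun r => zeta Φ r * f r) (u t ω x))
        (fun i t ω x => f (u t ω x) * G i t ω x)) ∧
    ∀ (η φ : ℝ → ℝ) (ϱ : Torus d → ℝ), IsEntropy η → IsTimeTest T φ → IsSmoothOnTorus ϱ →
      (∀ t : ℝ≥0, t ≤ T → ∀ x, 0 ≤ φ t * ϱ x) →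
      ∃ I : Ω → ℝ,
        IsItoIntegralL2 ℱ P W T
          (fun k t ω => ∫ x, deriv η (u t ω x) * (φ t * ϱ x) * σ (u t ω x) k) I ∧
        ∀ᵐ ω ∂P, EntropyInequality T Φ F σ ξ u ν G η φ ϱ I ω
  le_obstacle : ∀ᵐ ω ∂P, ∀ᵐ z ∂(spaceTime T d), u z.1 ω z.2 ≤ S z.1 ω
  skorokhod : ∀ᵐ ω ∂P, ∫ z, (u z.1 ω z.2 - S z.1 ω) * ν z.1 ω z.2 ∂(spaceTime T d) = 0

end StochasticPorousMedia

end

open StochasticPorousMedia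

noncomputable section

namespace StochasticPorousMedia

/-! ### Smooth approximations of the negative part -/

/-! Test the entropy inequality with a smooth convex `η` close to the negative part, with `η' ∈ [-1,
0]`, `η' = 0` on `[0, ∞)` and `η''` supported in `[-δ, 0]` with size at most `C / δ`; take `ϱ = 1`
and a time cutoff `φ` with `-φ' = N₀ φ + w`, `w ≥ 0`. The initial term vanishes because `ξ ≥ 0`, the
diffusion flux because `ϱ` is constant, and the gradient term has a favourable sign. As `F(t, x, 0)
= 0`, the source costs at most `N₀ u⁻ φ`, which the `N₀ φ` in `-φ'` absorbs, in place of a Gronwall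
argument. The reflection enters with the wrong sign, but only where `u < 0 ≤ S`, and there the
Skorokhod condition forces `ν = 0` (`IsEntropySolution.reflection_eq_zero`). The Itô correction is
of order `δ⁻¹ δ^(1 + 2κ) = δ^(2κ)`, since `σ` is Hölder of exponent `1/2 + κ` at its zero. This is
the pathwise bound `EntropyInequality.integral_negPart_le`. Taking expectations removes the
stochastic integral (`IsItoIntegralL2.integrable_and_integral_eq_zero`), and `δ → 0` gives `E ∫ u⁻ w
≤ 0`, so `u⁻ = 0` wherever `w > 0`. -/

/-- The derivative of the smooth approximation of `r ↦ r⁻`. -/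
def negPartApproxDeriv (δ r : ℝ) : ℝ := Real.smoothTransition (r / δ + 1) - 1

/-- A smooth convex approximation of the negative part `r ↦ r⁻`. -/
def negPartApprox (δ : ℝ) : ℝ → ℝ := primitive (negPartApproxDeriv δ)

lemma contDiff_negPartApproxDeriv (δ : ℝ) {n : ℕ∞} : ContDiff ℝ n (negPartApproxDeriv δ) := by
  unfold negPartApproxDeriv
  exact (Real.smoothTransition.contDiff.comp
    ((contDiff_id.div_const δ).add contDiff_const)).sub contDiff_const

lemma hasDerivAt_negPartApprox (δ r : ℝ) :
    HasDerivAt (negPartApprox δ) (negPartApproxDeriv δ r) r :=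
  have hc : Continuous (negPartApproxDeriv δ) := (contDiff_negPartApproxDeriv δ (n := 0)).continuous
  intervalIntegral.integral_hasDerivAt_right (hc.intervalIntegrable _ _)
    (hc.stronglyMeasurableAtFilter _ _) hc.continuousAt

lemma deriv_negPartApprox (δ : ℝ) : deriv (negPartApprox δ) = negPartApproxDeriv δ :=
  funext fun r => (hasDerivAt_negPartApprox δ r).deriv

lemma negPartApproxDeriv_nonpos (δ r : ℝ) : negPartApproxDeriv δ r ≤ 0 :=
  sub_nonpos.2 (Real.smoothTransition.le_one _)

lemma neg_one_le_negPartApproxDeriv (δ r : ℝ) : -1 ≤ negPartApproxDeriv δ r := by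
  have := Real.smoothTransition.nonneg (r / δ + 1)
  unfold negPartApproxDeriv; linarith

lemma negPartApproxDeriv_eq_zero {δ r : ℝ} (hδ : 0 < δ) (hr : 0 ≤ r) :
    negPartApproxDeriv δ r = 0 := by
  rw [negPartApproxDeriv, Real.smoothTransition.one_of_one_le, sub_self]
  have : 0 ≤ r / δ := by positivity
  linarith

lemma negPartApproxDeriv_eq_neg_one {δ r : ℝ} (hδ : 0 < δ) (hr : r ≤ -δ) :
    negPartApproxDeriv δ r = -1 := by
  rw [negPartApproxDeriv, Real.smoothTransition.zero_of_nonpos, zero_sub]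
  have : r / δ ≤ -1 := by rw [div_le_iff₀ hδ]; linarith
  linarith

lemma negPartApproxDeriv_monotone {δ : ℝ} (hδ : 0 < δ) : Monotone (negPartApproxDeriv δ) :=
  fun a b hab => by
    unfold negPartApproxDeriv
    have := Real.smoothTransition.monotone
      (add_le_add_left (div_le_div_of_nonneg_right hab hδ.le) 1)
    linarith

lemma negPartApprox_zero (δ : ℝ) : negPartApprox δ 0 = 0 := by
  simp [negPartApprox, primitive]

lemma negPartApprox_antitone (δ : ℝ) : Antitone (negPartApprox δ) :=
  antitone_of_deriv_nonpos (fun r => (hasDerivAt_negPartApprox δ r).differentiableAt)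
    fun r => by rw [deriv_negPartApprox]; exact negPartApproxDeriv_nonpos δ r

lemma negPartApprox_add_monotone (δ : ℝ) : Monotone fun r => negPartApprox δ r + r :=
  monotone_of_deriv_nonneg
    (fun r => ((hasDerivAt_negPartApprox δ r).add (hasDerivAt_id' r)).differentiableAt)
    fun r => by
      rw [((hasDerivAt_negPartApprox δ r).fun_add (hasDerivAt_id' r)).deriv]
      linarith [neg_one_le_negPartApproxDeriv δ r]

lemma negPartApprox_eq_zero {δ r : ℝ} (hδ : 0 < δ) (hr : 0 ≤ r) : negPartApprox δ r = 0 := by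
  rw [negPartApprox, primitive, intervalIntegral.integral_congr (g := fun _ => 0),
    intervalIntegral.integral_zero]
  intro s hs
  rw [Set.uIcc_of_le hr] at hs
  exact negPartApproxDeriv_eq_zero hδ hs.1

lemma negPartApprox_nonneg {δ : ℝ} (hδ : 0 < δ) (r : ℝ) : 0 ≤ negPartApprox δ r := by
  rcases le_total 0 r with hr | hr
  · exact (negPartApprox_eq_zero hδ hr).ge
  · simpa [negPartApprox_zero] using negPartApprox_antitone δ hr

lemma negPartApprox_le {δ : ℝ} (hδ : 0 < δ) (r : ℝ) : negPartApprox δ r ≤ max (-r) 0 := by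
  rcases le_total 0 r with hr | hr
  · exact (negPartApprox_eq_zero hδ hr).le.trans (le_max_right _ _)
  · have := negPartApprox_add_monotone δ hr
    simp only [negPartApprox_zero] at this
    exact le_max_of_le_left (by linarith)

/-- Left of `-δ` the slope is exactly `-1`, so the approximation runs parallel to `-r` there and can
only have lost height on `[-δ, 0]`, at most `δ`. -/
lemma sub_le_negPartApprox {δ : ℝ} (hδ : 0 < δ) (r : ℝ) :
    max (-r) 0 - δ ≤ negPartApprox δ r := by
  have h0 := negPartApprox_nonneg hδ r
  rcases le_total (-δ) r with hr | hr
  · rw [sub_le_iff_le_add]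
    exact max_le (by linarith) (by linarith)
  · have h1 : Convex ℝ (Set.Iic (-δ)) := convex_Iic _
    have h2 := h1.image_sub_le_mul_sub_of_deriv_le (f := negPartApprox δ) (C := -1)
      (fun x _ => (hasDerivAt_negPartApprox δ x).continuousAt.continuousWithinAt)
      (fun x _ => (hasDerivAt_negPartApprox δ x).differentiableAt.differentiableWithinAt)
      (fun x hx => by
        rw [interior_Iic] at hx
        rw [deriv_negPartApprox, negPartApproxDeriv_eq_neg_one hδ hx.le])
      r hr (-δ) Set.self_mem_Iic hr
    have h3 := negPartApprox_nonneg hδ (-δ)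
    rw [max_eq_left (by linarith)]
    linarith

lemma deriv_negPartApproxDeriv_nonneg {δ : ℝ} (hδ : 0 < δ) (r : ℝ) :
    0 ≤ deriv (negPartApproxDeriv δ) r :=
  (negPartApproxDeriv_monotone hδ).deriv_nonneg

lemma deriv_negPartApproxDeriv_eq_zero {δ r : ℝ} (hδ : 0 < δ) (hr : r ∉ Set.Icc (-δ) 0) :
    deriv (negPartApproxDeriv δ) r = 0 := by
  rw [Set.mem_Icc, not_and_or, not_le, not_le] at hr
  rcases hr with hr | hr
  · have : negPartApproxDeriv δ =ᶠ[𝓝 r] fun _ => -1 := by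
      filter_upwards [Iio_mem_nhds hr] with s hs using negPartApproxDeriv_eq_neg_one hδ hs.le
    rw [this.deriv_eq, deriv_const]
  · have : negPartApproxDeriv δ =ᶠ[𝓝 r] fun _ => 0 := by
      filter_upwards [Ioi_mem_nhds hr] with s hs using negPartApproxDeriv_eq_zero hδ hs.le
    rw [this.deriv_eq, deriv_const]

lemma isEntropy_negPartApprox {δ : ℝ} (hδ : 0 < δ) : IsEntropy (negPartApprox δ) where
  contDiff := by
    have h : ContDiff ℝ (1 + 1) (negPartApprox δ) := by
      rw [contDiff_succ_iff_deriv]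
      refine ⟨fun r => (hasDerivAt_negPartApprox δ r).differentiableAt, by simp, ?_⟩
      rw [deriv_negPartApprox]
      exact contDiff_negPartApproxDeriv δ
    simpa [one_add_one_eq_two] using h
  convex := Monotone.convexOn_univ_of_deriv
    (fun r => (hasDerivAt_negPartApprox δ r).differentiableAt)
    (by rw [deriv_negPartApprox]; exact negPartApproxDeriv_monotone hδ)
  compact := by
    rw [deriv_negPartApprox]
    exact HasCompactSupport.intro isCompact_Icc fun r hr =>
      deriv_negPartApproxDeriv_eq_zero hδ hr

/-- The second derivative of `negPartApprox δ` is of order `1 / δ`. -/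
lemma exists_deriv_negPartApproxDeriv_le :
    ∃ C : ℝ, 0 ≤ C ∧ ∀ δ : ℝ, 0 < δ → ∀ r, deriv (negPartApproxDeriv δ) r ≤ C / δ := by
  have hcont : Continuous (deriv (negPartApproxDeriv 1)) :=
    (contDiff_negPartApproxDeriv 1 (n := 1)).continuous_deriv le_rfl
  have hcomp : HasCompactSupport (deriv (negPartApproxDeriv 1)) :=
    deriv_negPartApprox 1 ▸ (isEntropy_negPartApprox one_pos).compact
  obtain ⟨C, hC⟩ := hcomp.exists_bound_of_continuous hcont
  refine ⟨C, (norm_nonneg _).trans (hC 0), fun δ hδ r => ?_⟩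
  -- The whole family is a rescaling of the case `δ = 1`, so the bound of that single compactly
  -- supported function serves every `δ`.
  have h1 : negPartApproxDeriv δ = fun r => negPartApproxDeriv 1 (r / δ) := by
    ext r; simp [negPartApproxDeriv]
  have h2 : HasDerivAt (negPartApproxDeriv δ) (deriv (negPartApproxDeriv 1) (r / δ) * (1 / δ)) r := by
    rw [h1]
    exact (((contDiff_negPartApproxDeriv 1 (n := 1)).differentiable (by simp)
      (r / δ)).hasDerivAt).comp r ((hasDerivAt_id' r).div_const δ)
  rw [h2.deriv, mul_one_div]
  exact div_le_div_of_nonneg_right ((le_abs_self _).trans (hC _)) hδ.le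

/-! ### Exponentially decaying time cutoffs -/

/-- A smooth function, positive on `(-∞, a)` and vanishing on `[a, ∞)`, that decays faster than
`exp (-N t)`. -/
def decayCutoff (N a t : ℝ) : ℝ := Real.exp (-N * t) * expNegInvGlue (a - t)

/-- The excess decay `-φ' - N φ` of `φ = decayCutoff N a`. -/
def decayWeight (N a t : ℝ) : ℝ :=
  Real.exp (-N * t) * ((a - t)⁻¹ ^ 2 * expNegInvGlue (a - t))

lemma decayCutoff_nonneg (N a t : ℝ) : 0 ≤ decayCutoff N a t :=
  mul_nonneg (Real.exp_pos _).le (expNegInvGlue.nonneg _)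

lemma decayWeight_nonneg (N a t : ℝ) : 0 ≤ decayWeight N a t :=
  mul_nonneg (Real.exp_pos _).le (mul_nonneg (sq_nonneg _) (expNegInvGlue.nonneg _))

lemma decayWeight_pos {N a t : ℝ} (h : t < a) : 0 < decayWeight N a t := by
  have h1 : 0 < a - t := sub_pos.2 h
  have h2 := expNegInvGlue.pos_of_pos h1
  unfold decayWeight
  positivity

lemma contDiff_decayCutoff (N a : ℝ) {n : ℕ∞} : ContDiff ℝ n (decayCutoff N a) :=
  (Real.contDiff_exp.comp (contDiff_const.mul contDiff_id)).mul
    (expNegInvGlue.contDiff.comp (contDiff_const.sub contDiff_id))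

/-- The exponential rate yields `N φ`, to be cancelled against the Lipschitz source; the cutoff
factor yields the nonnegative excess that later weighs `u⁻`. -/
lemma deriv_decayCutoff (N a t : ℝ) :
    deriv (decayCutoff N a) t = -(N * decayCutoff N a t + decayWeight N a t) := by
  have h1 : HasDerivAt expNegInvGlue ((a - t)⁻¹ ^ 2 * expNegInvGlue (a - t)) (a - t) := by
    simpa using expNegInvGlue.hasDerivAt_polynomial_eval_inv_mul 1 (a - t)
  have h2 : HasDerivAt (fun s => expNegInvGlue (a - s))
      ((a - t)⁻¹ ^ 2 * expNegInvGlue (a - t) * (-1)) t :=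
    h1.comp t ((hasDerivAt_id' t).const_sub a)
  have h3 : HasDerivAt (fun s : ℝ => Real.exp (-N * s)) (Real.exp (-N * t) * (-N * 1)) t :=
    ((hasDerivAt_id' t).const_mul (-N)).exp
  have h4 : HasDerivAt (decayCutoff N a) _ t := h3.mul h2
  rw [h4.deriv, decayCutoff, decayWeight]
  ring

lemma isTimeTest_decayCutoff (N : ℝ) {a : ℝ} {T : ℝ≥0} (ha : a < T) :
    IsTimeTest T (decayCutoff N a) where
  contDiff := contDiff_decayCutoff N a
  vanish := ⟨a, ha, fun t ht => by
    rw [decayCutoff, expNegInvGlue.zero_of_nonpos (by linarith), mul_zero]⟩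

/-! ### The Itô integral has mean zero -/

variable {Ω : Type*} {mΩ : MeasurableSpace Ω}

lemma IsWienerSequence.integrable_increment {ℱ : Filtration ℝ≥0 mΩ} {P : Measure Ω}
    {W : ℕ → ℝ≥0 → Ω → ℝ} (hW : IsWienerSequence ℱ P W) (k : ℕ) (s t : ℝ≥0) :
    Integrable (fun ω => W k t ω - W k s ω) P :=
  ((hW.brownian k).toIsPreBrownianReal.integrable_eval t).sub
    ((hW.brownian k).toIsPreBrownianReal.integrable_eval s)

lemma IsWienerSequence.integral_increment {ℱ : Filtration ℝ≥0 mΩ} {P : Measure Ω}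
    {W : ℕ → ℝ≥0 → Ω → ℝ} (hW : IsWienerSequence ℱ P W) (k : ℕ) (s t : ℝ≥0) :
    ∫ ω, (W k t ω - W k s ω) ∂P = 0 := by
  have hB := (hW.brownian k).toIsPreBrownianReal
  rw [integral_sub (hB.integrable_eval t) (hB.integrable_eval s), hB.integral_eval t,
    hB.integral_eval s, sub_zero]

/-- An increment of a Wiener process is orthogonal to bounded random variables of the past. -/
lemma IsWienerSequence.integral_mul_increment {ℱ : Filtration ℝ≥0 mΩ} {P : Measure Ω}
    {W : ℕ → ℝ≥0 → Ω → ℝ} (hW : IsWienerSequence ℱ P W) (k : ℕ) {s t : ℝ≥0} (hst : s ≤ t)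
    {c : Ω → ℝ} (hc : Measurable[ℱ s] c) :
    ∫ ω, c ω * (W k t ω - W k s ω) ∂P = 0 := by
  have hind : IndepFun c (fun ω => W k t ω - W k s ω) P := by
    rw [IndepFun_iff_Indep]
    refine indep_of_indep_of_le_left (indep_of_indep_of_le_right
      (hW.indep_past s t hst).symm ?_) hc.comap_le
    rintro _ ⟨B, hB, rfl⟩
    exact ⟨(fun f : ℕ → ℝ => f k) ⁻¹' B, measurable_pi_apply k hB, rfl⟩
  rw [hind.integral_fun_mul_eq_mul_integral (hc.mono (ℱ.le s) le_rfl).aestronglyMeasurable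
    (hW.integrable_increment k s t).aestronglyMeasurable, hW.integral_increment, mul_zero]

lemma ElementaryIntegrand.integrable_integral {ℱ : Filtration ℝ≥0 mΩ} {P : Measure Ω}
    {W : ℕ → ℝ≥0 → Ω → ℝ} (hW : IsWienerSequence ℱ P W) (V : ElementaryIntegrand ℱ) (T : ℝ≥0) :
    Integrable (V.integral W T) P := by
  refine integrable_finsetSum _ fun i _ => ?_
  obtain ⟨C, hC⟩ := V.bounded_coeff i
  exact (hW.integrable_increment _ _ _).bdd_mul
    ((V.measurable_coeff i).mono (ℱ.le _) le_rfl).aestronglyMeasurable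
    (ae_of_all _ fun ω => hC ω)

lemma ElementaryIntegrand.integral_integral {ℱ : Filtration ℝ≥0 mΩ} {P : Measure Ω}
    {W : ℕ → ℝ≥0 → Ω → ℝ} (hW : IsWienerSequence ℱ P W) (V : ElementaryIntegrand ℱ) (T : ℝ≥0) :
    ∫ ω, V.integral W T ω ∂P = 0 := by
  unfold ElementaryIntegrand.integral
  rw [integral_finsetSum _ fun i _ => ?_]
  · refine Finset.sum_eq_zero fun i _ => ?_
    -- Either the truncated interval still starts at `left i`, where the coefficient is measurable,
    -- or both endpoints collapse to `T` and the increment is zero.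
    rcases le_total (V.left i) T with h | h
    · rw [min_eq_left h]
      exact hW.integral_mul_increment _ (le_min (V.left_le_right i) h) (V.measurable_coeff i)
    · simp [min_eq_right h, min_eq_right (h.trans (V.left_le_right i))]
  · obtain ⟨C, hC⟩ := V.bounded_coeff i
    exact (hW.integrable_increment _ _ _).bdd_mul
      ((V.measurable_coeff i).mono (ℱ.le _) le_rfl).aestronglyMeasurable
      (ae_of_all _ fun ω => hC ω)

/-- The `L₂`-Itô integral is integrable with mean zero. -/
lemma IsItoIntegralL2.integrable_and_integral_eq_zero {ℱ : Filtration ℝ≥0 mΩ} {P : Measure Ω}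
    [IsProbabilityMeasure P] {W : ℕ → ℝ≥0 → Ω → ℝ} (hW : IsWienerSequence ℱ P W) {T : ℝ≥0}
    {H : ℕ → ℝ≥0 → Ω → ℝ} {I : Ω → ℝ} (hI : IsItoIntegralL2 ℱ P W T H I) :
    Integrable I P ∧ ∫ ω, I ω ∂P = 0 := by
  obtain ⟨-, hIm, V, -, hV⟩ := hI
  have hVI (n : ℕ) := (V n).integrable_integral hW T
  have hnorm (n : ℕ) : eLpNorm (fun ω => (V n).integral W T ω - I ω) 2 P =
      (∫⁻ ω, ENNReal.ofReal (((V n).integral W T ω - I ω) ^ 2) ∂P) ^ (1 / 2 : ℝ) := by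
    rw [eLpNorm_eq_lintegral_rpow_enorm_toReal (by simp) (by simp)]
    simp only [ENNReal.toReal_ofNat]
    congr 1
    refine lintegral_congr fun ω => ?_
    rw [← sq_abs, ENNReal.ofReal_pow (abs_nonneg _), ← Real.enorm_eq_ofReal_abs]
    norm_cast
  have h2 : Tendsto (fun n => eLpNorm (fun ω => (V n).integral W T ω - I ω) 2 P) atTop (𝓝 0) := by
    simp_rw [hnorm]
    have := (ENNReal.continuous_rpow_const (y := (1 / 2 : ℝ))).tendsto 0 |>.comp hV
    simpa [Function.comp_def] using this
  -- On a probability space `L₂` convergence implies `L₁` convergence, which is enough for the mean;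
  -- no isometry is needed.
  have h1 : Tendsto (fun n => eLpNorm (fun ω => (V n).integral W T ω - I ω) 1 P) atTop (𝓝 0) :=
    tendsto_of_tendsto_of_tendsto_of_le_of_le tendsto_const_nhds h2 (fun _ => zero_le)
      fun n => eLpNorm_le_eLpNorm_of_exponent_le (by norm_num)
        ((hVI n).aestronglyMeasurable.sub hIm)
  -- `I` is an elementary integral minus a difference that has finite `L₁` norm for some `n`.
  have hint : Integrable I P := by
    obtain ⟨n, hn⟩ := (h1.eventually_lt_const one_pos).exists
    have hd : Integrable (fun ω => (V n).integral W T ω - I ω) P :=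
      memLp_one_iff_integrable.1 ⟨(hVI n).aestronglyMeasurable.sub hIm, hn.trans (by simp)⟩
    simpa using (hVI n).sub' hd
  refine ⟨hint, ?_⟩
  have hlim := tendsto_integral_of_L1' I hint.aestronglyMeasurable (Eventually.of_forall hVI) h1
  simp_rw [(V _).integral_integral hW T] at hlim
  exact (tendsto_nhds_unique hlim tendsto_const_nhds)

/-! ### Space-time measures and slices of random fields -/

instance isFiniteMeasure_timeMeasure (T : ℝ≥0) : IsFiniteMeasure (timeMeasure T) := by
  unfold timeMeasure; infer_instance

instance isFiniteMeasure_spaceTime (T : ℝ≥0) (d : ℕ) : IsFiniteMeasure (spaceTime T d) := by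
  unfold spaceTime; infer_instance

instance isFiniteMeasure_timeOmega (P : Measure Ω) [IsFiniteMeasure P] (T : ℝ≥0) :
    IsFiniteMeasure (timeOmega P T) := by
  unfold timeOmega; infer_instance

lemma ae_timeMeasure_le (T : ℝ≥0) : ∀ᵐ t ∂timeMeasure T, t ≤ T := by
  rw [timeMeasure, ae_map_iff measurable_real_toNNReal.aemeasurable measurableSet_Iic]
  filter_upwards [ae_restrict_mem measurableSet_Icc] with t ht
  simpa using Real.toNNReal_le_toNNReal ht.2

lemma ae_timeMeasure_ne (T s : ℝ≥0) : ∀ᵐ t ∂timeMeasure T, t ≠ s := by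
  rw [timeMeasure, ae_map_iff (p := fun t => t ≠ s) measurable_real_toNNReal.aemeasurable
    (measurableSet_singleton s).compl]
  have h : ∀ᵐ t : ℝ, t ≠ s := by simp [ae_iff]
  filter_upwards [ae_restrict_mem measurableSet_Icc, ae_restrict_of_ae h] with t ht hts heq
  exact hts (by rw [← heq, Real.coe_toNNReal t ht.1])

lemma ae_spaceTime_of_ae_timeMeasure {T : ℝ≥0} (d : ℕ) {p : ℝ≥0 → Prop}
    (h : ∀ᵐ t ∂timeMeasure T, p t) : ∀ᵐ z ∂spaceTime T d, p z.1 :=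
  Measure.quasiMeasurePreserving_fst.ae h

/-- Putting `ω` first lets Fubini pass between global integrability of a field and integrability of
its path on `Q_T` for almost every `ω`. -/
lemma measurePreserving_reorder (P : Measure Ω) [IsFiniteMeasure P] (T : ℝ≥0) (d : ℕ) :
    MeasurePreserving (fun q : Ω × (ℝ≥0 × Torus d) => ((q.2.1, q.1), q.2.2))
      (P.prod (spaceTime T d)) ((timeOmega P T).prod volume) :=
  (Measure.measurePreserving_swap.prod (MeasurePreserving.id volume)).comp
    (measurePreserving_prodAssoc P (timeMeasure T) (volume : Measure (Torus d))).symm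

lemma MemLpField.memLp {d : ℕ} {P : Measure Ω} [IsFiniteMeasure P] {T : ℝ≥0} {p : ℝ}
    {v : ℝ≥0 → Ω → Torus d → ℝ} (h : MemLpField P T p v) :
    MemLp (fun q : Ω × (ℝ≥0 × Torus d) => v q.2.1 q.1 q.2.2) (ENNReal.ofReal p)
      (P.prod (spaceTime T d)) :=
  MemLp.comp_measurePreserving h (measurePreserving_reorder P T d)

lemma exists_ae_bound_comp_time {g : ℝ → ℝ} (hg : Continuous g) (T : ℝ≥0) (d : ℕ) :
    ∃ C, ∀ᵐ z ∂spaceTime T d, ‖g z.1‖ ≤ C := by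
  obtain ⟨C, hC⟩ := (isCompact_Icc (a := (0 : ℝ)) (b := T)).exists_bound_of_continuousOn
    hg.continuousOn
  exact ⟨C, ae_spaceTime_of_ae_timeMeasure d
    ((ae_timeMeasure_le T).mono fun t ht => hC t ⟨t.2, ht⟩)⟩

lemma measurable_comp_time {g : ℝ → ℝ} (hg : Continuous g) (d : ℕ) :
    Measurable fun z : ℝ≥0 × Torus d => g z.1 :=
  hg.measurable.comp (measurable_coe_nnreal_real.comp measurable_fst)

/-- Multiplication by a continuous function of time preserves integrability on `Q_T`. -/
lemma integrable_mul_comp_time {T : ℝ≥0} {d : ℕ} {g : ℝ → ℝ} (hg : Continuous g)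
    {v : ℝ≥0 × Torus d → ℝ} (hv : Integrable v (spaceTime T d)) :
    Integrable (fun z => v z * g z.1) (spaceTime T d) := by
  obtain ⟨C, hC⟩ := exists_ae_bound_comp_time hg T d
  exact hv.mul_bdd (measurable_comp_time hg d).aestronglyMeasurable hC

lemma integrable_comp_time {T : ℝ≥0} {d : ℕ} {g : ℝ → ℝ} (hg : Continuous g) :
    Integrable (fun z : ℝ≥0 × Torus d => g z.1) (spaceTime T d) := by
  simpa using integrable_mul_comp_time hg (integrable_const (1 : ℝ))

/-- A non-integrable `f` has Bochner integral `0`, which still lies below a nonnegative integral.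
This spares proving integrability of the source and gradient terms along a path. -/
lemma integral_le_integral_of_le_of_nonneg {α : Type*} {mα : MeasurableSpace α} {μ : Measure α}
    {f g : α → ℝ} (hg : Integrable g μ) (h0 : 0 ≤ᵐ[μ] g) (h : f ≤ᵐ[μ] g) :
    ∫ x, f x ∂μ ≤ ∫ x, g x ∂μ := by
  by_cases hf : Integrable f μ
  · exact integral_mono_ae hf hg h
  · rw [integral_undef hf]
    exact integral_nonneg_of_ae h0

lemma continuous_decayCutoff (N a : ℝ) : Continuous (decayCutoff N a) :=
  (contDiff_decayCutoff N a (n := 0)).continuous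

/-- The factor `(a - t)⁻¹` is singular at `a`, so continuity is read off from `w = -φ' - N φ` with
`φ` smooth. -/
lemma continuous_decayWeight (N a : ℝ) : Continuous (decayWeight N a) := by
  have h : decayWeight N a = fun t => -deriv (decayCutoff N a) t - N * decayCutoff N a t := by
    ext t; rw [deriv_decayCutoff]; ring
  rw [h]
  exact ((contDiff_decayCutoff N a (n := 1)).continuous_deriv le_rfl).neg.sub
    (continuous_const.mul (continuous_decayCutoff N a))

/-! ### The entropy inequality for the negative part -/

lemma DiffusionAssumption.tsum_sq_le {κ K : ℝ} {σ : ℝ → lp (fun _ : ℕ => ℝ) 2}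
    (hσ : DiffusionAssumption κ K σ) (hκ : 0 < κ) (hκ' : κ ≤ 1 / 2) (hK : 1 ≤ K) {δ r : ℝ}
    (hδ : 0 < δ) (hδ1 : δ ≤ 1) (hr : |r| ≤ δ) :
    ∑' k, |σ r k| ^ 2 ≤ 4 * K ^ 2 * (δ * δ ^ (2 * κ)) := by
  have h1 : ∑' k, |σ r k| ^ 2 = ‖σ r‖ ^ 2 := by
    have := lp.norm_rpow_eq_tsum (p := 2) (by simp) (σ r)
    simp only [ENNReal.toReal_ofNat, Real.rpow_two, Real.norm_eq_abs] at this
    exact this.symm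
  have h2 := hσ.holder r 0
  rw [hσ.zero, sub_zero, sub_zero] at h2
  have h3 : |r| ^ (1 / 2 + κ) ≤ δ ^ (1 / 2 + κ) :=
    Real.rpow_le_rpow (abs_nonneg r) hr (by linarith)
  -- Here `δ ≤ 1` and `κ ≤ 1/2` make the Hölder power dominate the linear part of the modulus.
  have h4 : δ ≤ δ ^ (1 / 2 + κ) := by
    simpa using Real.rpow_le_rpow_of_exponent_ge hδ hδ1 (show 1 / 2 + κ ≤ 1 by linarith)
  have h5 : ‖σ r‖ ≤ K * (2 * δ ^ (1 / 2 + κ)) :=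
    h2.trans (mul_le_mul_of_nonneg_left (by linarith) (by linarith))
  have h6 : (δ ^ (1 / 2 + κ)) ^ 2 = δ * δ ^ (2 * κ) := by
    rw [← Real.rpow_natCast, ← Real.rpow_mul hδ.le, ← Real.rpow_one_add' hδ.le (by positivity)]
    congr 1; push_cast; ring
  calc ∑' k, |σ r k| ^ 2 = ‖σ r‖ ^ 2 := h1
    _ ≤ (K * (2 * δ ^ (1 / 2 + κ))) ^ 2 := pow_le_pow_left₀ (norm_nonneg _) h5 2
    _ = 4 * K ^ 2 * (δ * δ ^ (2 * κ)) := by rw [← h6]; ring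

lemma partialDeriv_const {d : ℕ} (i : Fin d) (c : ℝ) (x : Torus d) :
    partialDeriv i (fun _ => c) x = 0 := by
  simp [partialDeriv]

lemma laplacian_const {d : ℕ} (c : ℝ) (x : Torus d) : laplacian (fun _ => c) x = 0 := by
  have h (i : Fin d) : partialDeriv i (fun _ : Torus d => c) = fun _ => 0 :=
    funext fun x => partialDeriv_const i c x
  simp [laplacian, h, partialDeriv_const]

/-- The pathwise estimate obtained from the entropy inequality for `negPartApprox δ`. -/
lemma EntropyInequality.integral_negPart_le {d : ℕ} {T : ℝ≥0} {Φ : ℝ → ℝ}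
    {F : ℝ≥0 → Torus d → ℝ → ℝ} {σ : ℝ → lp (fun _ : ℕ => ℝ) 2} {ξ : Ω → Torus d → ℝ}
    {u ν : ℝ≥0 → Ω → Torus d → ℝ} {G : Fin d → ℝ≥0 → Ω → Torus d → ℝ} {I : Ω → ℝ} {ω : Ω}
    {κ K N₀ δ C a : ℝ} (hκ : 0 < κ) (hκ' : κ ≤ 1 / 2) (hK : 1 ≤ K) (hN₀ : 0 ≤ N₀)
    (hσ : DiffusionAssumption κ K σ) (hF : SourceAssumption T κ K N₀ F)
    (hδ : 0 < δ) (hδ1 : δ ≤ 1) (hC0 : 0 ≤ C) (hC : ∀ r, deriv (negPartApproxDeriv δ) r ≤ C / δ)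
    (hE : EntropyInequality T Φ F σ ξ u ν G (negPartApprox δ) (decayCutoff N₀ a) (fun _ => 1) I ω)
    (hu : Integrable (fun z : ℝ≥0 × Torus d => u z.1 ω z.2) (spaceTime T d))
    (hξ : ∀ᵐ x, 0 ≤ ξ ω x)
    (hν : ∀ᵐ z ∂spaceTime T d, u z.1 ω z.2 < 0 → ν z.1 ω z.2 = 0) :
    ∫ z, max (-u z.1 ω z.2) 0 * decayWeight N₀ a z.1 ∂spaceTime T d ≤
      (δ + 2 * C * K ^ 2 * δ ^ (2 * κ)) *
        (∫ z, (N₀ * decayCutoff N₀ a z.1 + decayWeight N₀ a z.1 + decayCutoff N₀ a z.1)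
          ∂spaceTime T d) + I ω := by
  set φ := decayCutoff N₀ a with hφ
  set w := decayWeight N₀ a with hw
  have hφc : Continuous φ := continuous_decayCutoff N₀ a
  have hwc : Continuous w := continuous_decayWeight N₀ a
  have hφ0 : ∀ t, 0 ≤ φ t := decayCutoff_nonneg N₀ a
  have hw0 : ∀ t, 0 ≤ w t := decayWeight_nonneg N₀ a
  have hdc : Continuous fun t => N₀ * φ t + w t := (continuous_const.mul hφc).add hwc
  have hd0 : ∀ t, 0 ≤ N₀ * φ t + w t := fun t => add_nonneg (mul_nonneg hN₀ (hφ0 t)) (hw0 t)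
  set c : ℝ := 2 * C * K ^ 2 * δ ^ (2 * κ) with hc
  have hc0 : 0 ≤ c := by positivity
  have hum : Integrable (fun z : ℝ≥0 × Torus d => max (-u z.1 ω z.2) 0) (spaceTime T d) :=
    hu.neg.pos_part
  have hη : Integrable (fun z : ℝ≥0 × Torus d => negPartApprox δ (u z.1 ω z.2))
      (spaceTime T d) := by
    refine hum.mono' ?_ (ae_of_all _ fun z => ?_)
    · exact (isEntropy_negPartApprox hδ).contDiff.continuous.comp_aestronglyMeasurable
        hu.aestronglyMeasurable
    · rw [Real.norm_of_nonneg (negPartApprox_nonneg hδ _)]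
      exact negPartApprox_le hδ _
  -- The reflection never contributes: `η'(u) = 0` when `u ≥ 0`, and `ν = 0` when `u < 0`.
  have hsrc : ∀ᵐ z ∂spaceTime T d, negPartApproxDeriv δ (u z.1 ω z.2) *
      (F z.1 z.2 (u z.1 ω z.2) - ν z.1 ω z.2) * (φ z.1 * 1) ≤
      N₀ * (max (-u z.1 ω z.2) 0 * φ z.1) := by
    filter_upwards [hν, ae_spaceTime_of_ae_timeMeasure d (ae_timeMeasure_le T)] with z hz ht
    rcases le_or_gt 0 (u z.1 ω z.2) with h0 | h0
    · rw [negPartApproxDeriv_eq_zero hδ h0, zero_mul, zero_mul]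
      exact mul_nonneg hN₀ (mul_nonneg (le_max_right _ _) (hφ0 _))
    · rw [hz h0, sub_zero, mul_one, ← mul_assoc, max_eq_left (by linarith)]
      refine mul_le_mul_of_nonneg_right ?_ (hφ0 _)
      -- Comparing at the same point `x` removes the spatial modulus, as `0 ^ κ = 0` for `κ > 0`.
      have h1 := hF.holder z.1 ht z.2 z.2 (u z.1 ω z.2) 0
      have h2 : torusDist z.2 z.2 = 0 := by simp [torusDist]
      rw [hF.zero z.1 ht, sub_zero, sub_zero, h2, Real.zero_rpow hκ.ne', mul_zero, zero_add,
        abs_of_neg h0] at h1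
      have h3 : |negPartApproxDeriv δ (u z.1 ω z.2)| ≤ 1 :=
        abs_le.2 ⟨neg_one_le_negPartApproxDeriv _ _,
          (negPartApproxDeriv_nonpos _ _).trans zero_le_one⟩
      calc _ ≤ |negPartApproxDeriv δ (u z.1 ω z.2) * F z.1 z.2 (u z.1 ω z.2)| := le_abs_self _
        _ ≤ 1 * |F z.1 z.2 (u z.1 ω z.2)| := by
          rw [abs_mul]; exact mul_le_mul_of_nonneg_right h3 (abs_nonneg _)
        _ ≤ _ := by rw [one_mul]; exact h1
  have hdiff (z : ℝ≥0 × Torus d) : 1 / 2 * deriv (negPartApproxDeriv δ) (u z.1 ω z.2) *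
        (∑' k, |σ (u z.1 ω z.2) k| ^ 2) * (φ z.1 * 1) -
      deriv (negPartApproxDeriv δ) (u z.1 ω z.2) * (∑ i, G i z.1 ω z.2 ^ 2) * (φ z.1 * 1) ≤
      c * φ z.1 := by
    have hd := deriv_negPartApproxDeriv_nonneg hδ (u z.1 ω z.2)
    have h1 : 0 ≤ deriv (negPartApproxDeriv δ) (u z.1 ω z.2) * (∑ i, G i z.1 ω z.2 ^ 2) *
        (φ z.1 * 1) :=
      mul_nonneg (mul_nonneg hd (Finset.sum_nonneg fun i _ => sq_nonneg _))
        (by rw [mul_one]; exact hφ0 _)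
    refine (sub_le_self _ h1).trans ?_
    rw [mul_one]
    refine mul_le_mul_of_nonneg_right ?_ (hφ0 _)
    by_cases hr : u z.1 ω z.2 ∈ Set.Icc (-δ) 0
    · have h2 := hσ.tsum_sq_le hκ hκ' hK hδ hδ1 (r := u z.1 ω z.2)
        (abs_le.2 ⟨hr.1, hr.2.trans hδ.le⟩)
      -- The factor `1 / δ` from `η''` cancels one power of `δ` in the bound on `|σ|²`, leaving
      -- `δ^(2κ)`.
      calc _ ≤ 1 / 2 * (C / δ) * (4 * K ^ 2 * (δ * δ ^ (2 * κ))) :=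
            mul_le_mul (mul_le_mul_of_nonneg_left (hC _) (by norm_num)) h2
              (tsum_nonneg fun k => sq_nonneg _) (by positivity)
        _ = c := by rw [hc]; field_simp; ring
    · rw [deriv_negPartApproxDeriv_eq_zero hδ hr]
      simpa using hc0
  unfold EntropyInequality at hE
  rw [deriv_negPartApprox] at hE
  have e1 : -∫ z, negPartApprox δ (u z.1 ω z.2) * (deriv φ z.1 * 1) ∂spaceTime T d =
      ∫ z, negPartApprox δ (u z.1 ω z.2) * (N₀ * φ z.1 + w z.1) ∂spaceTime T d := by
    rw [← integral_neg]
    refine integral_congr_ae (ae_of_all _ fun z => ?_)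
    simp only [hφ, hw, deriv_decayCutoff]
    ring
  have e2 : ∫ x, negPartApprox δ (ξ ω x) * (φ 0 * 1) = 0 := by
    refine integral_eq_zero_of_ae (hξ.mono fun x hx => ?_)
    simp [negPartApprox_eq_zero hδ hx]
  have e3 : ∫ z, primitive (fun r => zeta Φ r ^ 2 * negPartApproxDeriv δ r) (u z.1 ω z.2) *
      (φ z.1 * laplacian (fun _ => 1) z.2) ∂spaceTime T d = 0 := by
    simp [laplacian_const]
  have e4 := integral_le_integral_of_le_of_nonneg
    ((integrable_mul_comp_time hφc hum).const_mul N₀)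
    (ae_of_all _ fun z => mul_nonneg hN₀ (mul_nonneg (le_max_right _ _) (hφ0 _))) hsrc
  have e5 := integral_le_integral_of_le_of_nonneg
    ((integrable_comp_time (T := T) (d := d) hφc).const_mul c)
    (ae_of_all _ fun z => mul_nonneg hc0 (hφ0 _)) (ae_of_all _ hdiff)
  have e6 : ∫ z, (max (-u z.1 ω z.2) 0 * (N₀ * φ z.1 + w z.1) - δ * (N₀ * φ z.1 + w z.1))
        ∂spaceTime T d ≤
      ∫ z, negPartApprox δ (u z.1 ω z.2) * (N₀ * φ z.1 + w z.1) ∂spaceTime T d := by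
    refine integral_mono ((integrable_mul_comp_time hdc hum).sub
      ((integrable_comp_time hdc).const_mul δ)) (integrable_mul_comp_time hdc hη) fun z => ?_
    simp only
    rw [← sub_mul]
    exact mul_le_mul_of_nonneg_right (sub_le_negPartApprox hδ _) (hd0 _)
  have e7 : ∫ z, max (-u z.1 ω z.2) 0 * (N₀ * φ z.1 + w z.1) ∂spaceTime T d =
      (∫ z, N₀ * (max (-u z.1 ω z.2) 0 * φ z.1) ∂spaceTime T d) +
      ∫ z, max (-u z.1 ω z.2) 0 * w z.1 ∂spaceTime T d := by
    rw [← integral_add ((integrable_mul_comp_time hφc hum).const_mul N₀)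
      (integrable_mul_comp_time hwc hum)]
    congr 1; ext z; ring
  rw [integral_sub (integrable_mul_comp_time hdc hum) ((integrable_comp_time hdc).const_mul δ), e7,
    integral_const_mul δ] at e6
  have e8 : 0 ≤ ∫ z : ℝ≥0 × Torus d, (N₀ * φ z.1 + w z.1) ∂spaceTime T d :=
    integral_nonneg fun z => hd0 _
  have e9 : 0 ≤ ∫ z : ℝ≥0 × Torus d, φ z.1 ∂spaceTime T d := integral_nonneg fun z => hφ0 _
  rw [e1, e2, e3] at hE
  rw [integral_const_mul c] at e5
  -- The errors are `δ ∫ (N₀ φ + w)` and `c ∫ φ`; adding the nonnegative cross terms merges them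
  -- into one product.
  rw [integral_add (integrable_comp_time hdc) (integrable_comp_time hφc)]
  have e10 := mul_nonneg hδ.le e9
  have e11 := mul_nonneg hc0 e8
  linarith

/-- The Skorokhod condition: the reflection term vanishes where the solution is negative. -/
lemma IsEntropySolution.reflection_eq_zero {d : ℕ} {ℱ : Filtration ℝ≥0 mΩ} {P : Measure Ω}
    [IsProbabilityMeasure P] {W : ℕ → ℝ≥0 → Ω → ℝ} {T : ℝ≥0} {m : ℝ} {Φ : ℝ → ℝ}
    {F : ℝ≥0 → Torus d → ℝ → ℝ} {σ : ℝ → lp (fun _ : ℕ => ℝ) 2} {ξ : Ω → Torus d → ℝ}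
    {S h : ℝ≥0 → Ω → ℝ} {u ν : ℝ≥0 → Ω → Torus d → ℝ} (hm : 1 < m)
    (hS : ObstacleAssumption ℱ P W T σ ξ h S)
    (hu : IsEntropySolution ℱ P W T m Φ F σ ξ S u ν) :
    ∀ᵐ ω ∂P, ∀ᵐ z ∂spaceTime T d, u z.1 ω z.2 < 0 → ν z.1 ω z.2 = 0 := by
  -- Since `m + 1 ≥ 2` and the measure is finite, `u` is square integrable, so `u ν` is integrable.
  have hu2 := hu.mem_u.memLp.mono_exponent (p := 2)
    (by rw [← ENNReal.ofReal_ofNat 2]; exact ENNReal.ofReal_le_ofReal (by linarith))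
  have hν2 := hu.mem_ν.memLp
  rw [ENNReal.ofReal_ofNat] at hν2
  have huν := hu2.integrable_mul hν2
  have hν1 := hν2.integrable (by norm_num)
  filter_upwards [huν.prod_right_ae, hν1.prod_right_ae, hu.nonneg_ν, hu.le_obstacle, hu.skorokhod,
    hS.continuous, hS.nonneg] with ω huνω hνω hν0 hle hsk hcont hS0
  -- Along a fixed path, continuity on the compact interval gives both measurability and boundedness
  -- of `S`.
  have hSm : AEStronglyMeasurable (fun t => S t ω) (timeMeasure T) := by
    have h1 : (timeMeasure T).restrict (Set.Iic T) = timeMeasure T :=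
      Measure.restrict_eq_self_of_ae_mem (ae_timeMeasure_le T)
    rw [← h1]
    exact hcont.aestronglyMeasurable measurableSet_Iic
  obtain ⟨C, hC⟩ : ∃ C, ∀ t ∈ Set.Iic T, ‖S t ω‖ ≤ C := by
    have h1 : IsCompact (Set.Iic T) := by
      rw [← Set.Icc_bot]; exact isCompact_Icc
    exact h1.exists_bound_of_continuousOn hcont
  have hSν : Integrable (fun z : ℝ≥0 × Torus d => S z.1 ω * ν z.1 ω z.2) (spaceTime T d) :=
    hνω.bdd_mul (hSm.comp_quasiMeasurePreserving Measure.quasiMeasurePreserving_fst)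
      (ae_spaceTime_of_ae_timeMeasure d ((ae_timeMeasure_le T).mono fun t ht => hC t ht))
  have hint : Integrable (fun z : ℝ≥0 × Torus d => -((u z.1 ω z.2 - S z.1 ω) * ν z.1 ω z.2))
      (spaceTime T d) := by
    refine (huνω.sub hSν).neg.congr (ae_of_all _ fun z => ?_)
    simp only [Pi.neg_apply, Pi.sub_apply, Pi.mul_apply]
    ring
  have hnn : 0 ≤ᵐ[spaceTime T d] fun z => -((u z.1 ω z.2 - S z.1 ω) * ν z.1 ω z.2) := by
    filter_upwards [hν0, hle] with z h1 h2
    exact neg_nonneg.2 (mul_nonpos_of_nonpos_of_nonneg (sub_nonpos.2 h2) h1)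
  -- The integrand `(S - u) ν` is nonnegative and integrable with zero integral, so it vanishes
  -- almost everywhere.
  have hzero := (integral_eq_zero_iff_of_nonneg_ae hnn hint).1 (by rw [integral_neg, hsk, neg_zero])
  filter_upwards [hzero, ae_spaceTime_of_ae_timeMeasure d (ae_timeMeasure_le T)] with z hz ht hneg
  have h1 : u z.1 ω z.2 - S z.1 ω ≠ 0 := by linarith [hS0 z.1 ht] |> ne_of_lt
  exact (mul_eq_zero.1 (neg_eq_zero.1 hz)).resolve_left h1

/-- The expected negative part of an entropy solution vanishes before any time `a < T`. -/
lemma IsEntropySolution.integral_negPart_nonpos {d : ℕ} {ℱ : Filtration ℝ≥0 mΩ} {P : Measure Ω}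
    [IsProbabilityMeasure P] {W : ℕ → ℝ≥0 → Ω → ℝ} (hW : IsWienerSequence ℱ P W) {T : ℝ≥0}
    {m κ K N₀ : ℝ} (hm : 1 < m) (hκ : 0 < κ) (hκ' : κ ≤ 1 / 2) (hK : 1 ≤ K) (hN₀ : 0 ≤ N₀)
    {Φ : ℝ → ℝ} {ξ : Ω → Torus d → ℝ} (hξ : InitialAssumption ℱ P m ξ)
    {σ : ℝ → lp (fun _ : ℕ => ℝ) 2} (hσ : DiffusionAssumption κ K σ)
    {F : ℝ≥0 → Torus d → ℝ → ℝ} (hF : SourceAssumption T κ K N₀ F)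
    {h S : ℝ≥0 → Ω → ℝ} (hS : ObstacleAssumption ℱ P W T σ ξ h S)
    {u ν : ℝ≥0 → Ω → Torus d → ℝ} (hu : IsEntropySolution ℱ P W T m Φ F σ ξ S u ν)
    {a : ℝ} (ha : a < T) :
    Integrable (fun q : Ω × (ℝ≥0 × Torus d) =>
      max (-u q.2.1 q.1 q.2.2) 0 * decayWeight N₀ a q.2.1) (P.prod (spaceTime T d)) ∧
    ∫ q, max (-u q.2.1 q.1 q.2.2) 0 * decayWeight N₀ a q.2.1 ∂P.prod (spaceTime T d) ≤ 0 := by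
  have hu1 := hu.mem_u.memLp.integrable (by
    rw [← ENNReal.ofReal_one]; exact ENNReal.ofReal_le_ofReal (by linarith))
  have hint : Integrable (fun q : Ω × (ℝ≥0 × Torus d) =>
      max (-u q.2.1 q.1 q.2.2) 0 * decayWeight N₀ a q.2.1) (P.prod (spaceTime T d)) := by
    obtain ⟨C, hC⟩ :=
      exists_ae_bound_comp_time (continuous_decayWeight N₀ a) T d
    exact hu1.neg.pos_part.mul_bdd
      ((measurable_comp_time (continuous_decayWeight N₀ a) d).comp
        measurable_snd).aestronglyMeasurable
      (Measure.quasiMeasurePreserving_snd.ae hC)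
  refine ⟨hint, ?_⟩
  obtain ⟨C, hC0, hC⟩ := exists_deriv_negPartApproxDeriv_le
  obtain ⟨G, -, -, hent⟩ := hu.gradient_and_entropy
  set M := ∫ z : ℝ≥0 × Torus d,
    (N₀ * decayCutoff N₀ a z.1 + decayWeight N₀ a z.1 + decayCutoff N₀ a z.1) ∂spaceTime T d
  -- The stochastic integral `I` depends on `δ`, so the expectation is taken before `δ → 0`; `C` and
  -- `M` do not depend on `δ`.
  have hbound : ∀ δ : ℝ, 0 < δ → δ ≤ 1 →
      ∫ q, max (-u q.2.1 q.1 q.2.2) 0 * decayWeight N₀ a q.2.1 ∂P.prod (spaceTime T d) ≤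
        (δ + 2 * C * K ^ 2 * δ ^ (2 * κ)) * M := by
    intro δ hδ hδ1
    obtain ⟨I, hI, hE⟩ := hent (negPartApprox δ) (decayCutoff N₀ a) (fun _ => 1)
      (isEntropy_negPartApprox hδ) (isTimeTest_decayCutoff N₀ ha) contDiff_const
      (fun t _ x => by rw [mul_one]; exact decayCutoff_nonneg _ _ _)
    obtain ⟨hIint, hI0⟩ := hI.integrable_and_integral_eq_zero hW
    have hpath : ∀ᵐ ω ∂P,
        ∫ z, max (-u z.1 ω z.2) 0 * decayWeight N₀ a z.1 ∂spaceTime T d ≤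
          (δ + 2 * C * K ^ 2 * δ ^ (2 * κ)) * M + I ω := by
      filter_upwards [hE, hu1.prod_right_ae, Measure.ae_ae_of_ae_prod hξ.nonneg,
        hu.reflection_eq_zero hm hS] with ω h1 h2 h3 h4
      exact h1.integral_negPart_le hκ hκ' hK hN₀ hσ hF hδ hδ1 hC0 (hC δ hδ) h2 h3 h4
    rw [integral_prod _ hint]
    refine (integral_mono_ae hint.integral_prod_left
      ((integrable_const _).add hIint) hpath).trans_eq ?_
    simp only [Pi.add_apply]
    rw [integral_add (integrable_const _) hIint, hI0, integral_const]
    simp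
  have hlim : Tendsto (fun δ : ℝ => (δ + 2 * C * K ^ 2 * δ ^ (2 * κ)) * M) (𝓝[>] 0) (𝓝 0) := by
    have h1 : Continuous fun δ : ℝ => (δ + 2 * C * K ^ 2 * δ ^ (2 * κ)) * M :=
      (continuous_id.add (continuous_const.mul
        (Real.continuous_rpow_const (by positivity)))).mul continuous_const
    have h2 := (h1.tendsto 0).mono_left (nhdsWithin_le_nhds (s := Set.Ioi 0))
    simpa [Real.zero_rpow (show 2 * κ ≠ 0 by positivity)] using h2
  refine ge_of_tendsto hlim ?_
  filter_upwards [Ioc_mem_nhdsGT one_pos] with δ hδ using hbound δ hδ.1 hδ.2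

end StochasticPorousMedia

end

theorem mainTheorem4 {Ω : Type*} [mΩ : MeasurableSpace Ω]
    (P : Measure Ω) [IsProbabilityMeasure P]
    (ℱ : Filtration ℝ≥0 mΩ) (hℱ : ∀ A : Set Ω, P A = 0 → MeasurableSet[ℱ 0] A)
    (W : ℕ → ℝ≥0 → Ω → ℝ) (hW : IsWienerSequence ℱ P W)
    (d : ℕ) (T : ℝ≥0) (hT : 0 < T)
    (m κ K N₀ : ℝ) (hm : 1 < m) (hκ : 0 < κ) (hκ' : κ ≤ 1 / 2) (hK : 1 ≤ K) (hN₀ : 0 ≤ N₀)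
    (Φ : ℝ → ℝ) (hΦ : NonlinearityAssumption m K Φ)
    (ξ : Ω → Torus d → ℝ) (hξ : InitialAssumption ℱ P m ξ)
    (σ : ℝ → lp (fun _ : ℕ => ℝ) 2) (hσ : DiffusionAssumption κ K σ)
    (F : ℝ≥0 → Torus d → ℝ → ℝ) (hF : SourceAssumption T κ K N₀ F)
    (h S : ℝ≥0 → Ω → ℝ) (hS : ObstacleAssumption ℱ P W T σ ξ h S)
    (u ν : ℝ≥0 → Ω → Torus d → ℝ)
    (hu : IsEntropySolution ℱ P W T m Φ F σ ξ S u ν) :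
    ∀ᵐ ω ∂P, ∀ᵐ z ∂(spaceTime T d), 0 ≤ u z.1 ω z.2 := by
  -- A time test must vanish before `T`, so each cutoff only controls times below some `a < T`; the
  -- choice `a = T - 1/(n+1)` exhausts `[0, T)`, and the remaining slice `t = T` is null.
  have hbefore : ∀ n : ℕ, ∀ᵐ ω ∂P, ∀ᵐ z ∂spaceTime T d,
      (z.1 : ℝ) < T - 1 / ((n : ℝ) + 1) → 0 ≤ u z.1 ω z.2 := by
    intro n
    have ha : (T : ℝ) - 1 / ((n : ℝ) + 1) < T := sub_lt_self _ Nat.one_div_pos_of_nat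
    obtain ⟨hint, hle⟩ :=
      hu.integral_negPart_nonpos hW hm hκ hκ' hK hN₀ hξ hσ hF hS ha
    have hnn : ∀ q : Ω × (ℝ≥0 × Torus d),
        0 ≤ max (-u q.2.1 q.1 q.2.2) 0 * decayWeight N₀ (T - 1 / ((n : ℝ) + 1)) q.2.1 :=
      fun q => mul_nonneg (le_max_right _ _) (decayWeight_nonneg _ _ _)
    have hzero := (integral_eq_zero_iff_of_nonneg hnn hint).1
      (hle.antisymm (integral_nonneg hnn))
    filter_upwards [Measure.ae_ae_of_ae_prod hzero] with ω hω
    filter_upwards [hω] with z hz hlt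
    have h1 := (mul_eq_zero.1 hz).resolve_right (decayWeight_pos hlt).ne'
    linarith [le_max_left (-u z.1 ω z.2) 0]
  filter_upwards [ae_all_iff.2 hbefore] with ω hω
  filter_upwards [ae_all_iff.2 hω, ae_spaceTime_of_ae_timeMeasure d (ae_timeMeasure_le T),
    ae_spaceTime_of_ae_timeMeasure d (ae_timeMeasure_ne T T)] with z hz hle hne
  have hlt : (z.1 : ℝ) < T := NNReal.coe_lt_coe.2 (lt_of_le_of_ne hle hne)
  obtain ⟨n, hn⟩ := exists_nat_one_div_lt (sub_pos.2 hlt)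
  exact hz n (by linarith)
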